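/- **Theorem 3.4.** Let $k,n\ge 0$ and $d\ge 1$ be integers, and let $\mathbb T^k=[-1/2,1/2)^k$ with its Borel sets and Lebesgue measure. Write $\mathbb R_+=[0,\infty)$. For $v\in\mathbb R^m$ let $v^\downarrow$ denote the rearrangement of $v$ in non-increasing order. For $a\in\mathbb R^n$ and $b\in\mathbb R^d$ write $a\prec b$ ($a$ is majorized by $b$) if $$\sum_{i=1}^r a_i^\downarrow\le\sum_{i=1}^r b_i^\downarrow\quad(1\le r\le\min\{n,d\})\qquad\text{and}\qquad \sum_{i=1}^n a_i=\sum_{i=1}^d b_i .$$ For $y\in\mathbb C^d$ let $D_y$ be the diagonal $d\times d$ matrix with main diagonal $y$, and for $u\in\mathbb C^d$ let $u\otimes u$ be the $d\times d$ matrix with $(u\otimes u)z=\langle z,u\rangle u$ for all $z\in\mathbb C^d$, that is, with entries $u_i\overline{u_j}$. Let $b:\mathbb T^k\to(\mathbb R_+)^d$ and $c:\mathbb T^k\to(\mathbb R_+)^n$ be measurable. The following statements are equivalent: 1. $c(x)\prec b(x)$ for a.e. $x\in\mathbb T^k$. 2. There exist measurable $u_j:\mathbb T^k\to\mathbb C^d$,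 $1\le j\le n$, such that $\|u_j(x)\|=1$ (Euclidean norm) for every $j$ and a.e. $x\in\mathbb T^k$, and $$D_{b(x)}=\sum_{j=1}^n c_j(x)\,u_j(x)\otimes u_j(x)\qquad\text{for a.e. }x\in\mathbb T^k .$$ -/

import Mathlib

open MeasureTheory

namespace FrameSchurHorn

/-- The one-dimensional torus `[-1/2, 1/2)`. -/
abbrev Circle1 : Type := Set.Ico (-(1 / 2) : ℝ) (1 / 2)

/-- Lebesgue measure on the Borel sets of `[-1/2, 1/2)`. -/
noncomputable instance instMeasureSpaceCircle1 : MeasureSpace Circle1 :=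
  Measure.Subtype.measureSpace

theorem volume_circle1_univ : (volume : Measure Circle1) Set.univ = 1 := by
  change (volume : Measure (Set.Ico (-(1 / 2) : ℝ) (1 / 2))) Set.univ = 1
  rw [Measure.Subtype.volume_univ measurableSet_Ico.nullMeasurableSet, Real.volume_Ico]
  norm_num

/-- The `k`-torus `[-1/2, 1/2)^k`. Its σ-algebra is the product of the Borel σ-algebras of the factors
and `volume` is the product of the Lebesgue measures of the factors. -/
abbrev Torus (k : ℕ) : Type := Fin k → Circle1

/-- The rearrangement of a real vector in non-increasing order. -/
noncomputable def decRearr {n : ℕ} (a : Fin n → ℝ) : Fin n → ℝ :=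
  fun i => a (Tuple.sort a (Fin.rev i))

theorem decRearr_antitone {n : ℕ} (a : Fin n → ℝ) : Antitone (decRearr a) :=
  fun _ _ h => Tuple.monotone_sort a (Fin.rev_le_rev.mpr h)

theorem decRearr_eq_comp_perm {n : ℕ} (a : Fin n → ℝ) :
    ∃ σ : Equiv.Perm (Fin n), decRearr a = a ∘ σ :=
  ⟨Fin.revPerm.trans (Tuple.sort a), rfl⟩

/-- The sum of the first `r` entries of the non-increasing rearrangement of `a`. -/
noncomputable def topSum {n : ℕ} (a : Fin n → ℝ) (r : ℕ) : ℝ :=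
  ∑ i : Fin n with i.val < r, decRearr a i

/-- Majorization `a ≺ b` between real vectors of possibly different lengths `n` and `m`. -/
def Majorized {n m : ℕ} (a : Fin n → ℝ) (b : Fin m → ℝ) : Prop :=
  (∀ r : ℕ, 1 ≤ r → r ≤ min n m → topSum a r ≤ topSum b r) ∧ ∑ i, a i = ∑ i, b i

/-- The rank one matrix `x ⊗ y`, with entries `x i * conj (y j)`. -/
def tensor {d : ℕ} (x y : EuclideanSpace ℂ (Fin d)) : Matrix (Fin d) (Fin d) ℂ :=
  Matrix.of fun i j => x i * star (y j)

/-- As an operator, `x ⊗ y` maps `z` to `⟨z, y⟩ x`. The inner product is linear in `z`, which Mathlib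
writes as the second argument of `inner`. -/
theorem toEuclideanLin_tensor {d : ℕ} (x y z : EuclideanSpace ℂ (Fin d)) :
    Matrix.toEuclideanLin (tensor x y) z = inner ℂ y z • x := by
  ext i
  simp only [Matrix.toLpLin_apply, Matrix.mulVec, dotProduct, tensor, Matrix.of_apply,
    PiLp.smul_apply, smul_eq_mul, PiLp.inner_apply, RCLike.inner_apply, Finset.sum_mul]
  refine Finset.sum_congr rfl fun j _ => ?_
  simp only [starRingEnd_apply]
  ring

end FrameSchurHorn

/-! Pointwise this is a Schur–Horn theorem for frames. For existence, scaled basis vectors already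
have frame matrix `D_b`, with squared norms the entries of `b`. Rotating a pair of vectors keeps the
frame matrix and moves the two squared norms towards each other (`IsFrameNormSq.update`), and such
moves lead from `b` to any majorized `c` (`of_partialSums_le`). For necessity, the numbers `c j * ‖u
j i‖ ^ 2 / b i` form a doubly substochastic matrix, so sums of entries of `c` are weighted sums of
`b` (`majorized_of_frame`). Measurability comes from Borel selection: the frame equation is closed
in `(b, c, u)` and the `u` range over a compact product of spheres. -/

namespace FrameSchurHorn

/-! ### Measurable selection -/

/-- A closed relation with values in a compact metrizable space has a Borel selector on its domain:
parametrize the compact space by the Cantor set and take the least parameter in every fibre. -/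
theorem exists_measurable_selector_of_isClosed {X Y : Type*} [TopologicalSpace X]
    [MeasurableSpace X] [OpensMeasurableSpace X] [MetricSpace Y] [CompactSpace Y] [Nonempty Y]
    [MeasurableSpace Y] [BorelSpace Y] {R : Set (X × Y)} (hR : IsClosed R) :
    ∃ f : X → Y, Measurable f ∧ ∀ x, (∃ y, (x, y) ∈ R) → (x, f x) ∈ R := by
  classical
  obtain ⟨g₀, hg₀, hg₀s⟩ := exists_nat_bool_continuous_surjective_of_compact Y
  let g : cantorSet → Y := g₀ ∘ cantorSetHomeomorphNatToBool
  have hg : Continuous g := hg₀.comp cantorSetHomeomorphNatToBool.continuous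
  have hgs : Function.Surjective g := hg₀s.comp cantorSetHomeomorphNatToBool.surjective
  have : CompactSpace cantorSet := isCompact_iff_compactSpace.mp isCompact_cantorSet
  have hR' : IsClosed {p : X × cantorSet | (p.1, g p.2) ∈ R} :=
    hR.preimage (continuous_fst.prodMk (hg.comp continuous_snd))
  let dom : Set X := {x | ∃ z, (x, g z) ∈ R}
  have hdom : IsClosed dom := by
    convert isClosedMap_fst_of_compactSpace _ hR' using 1
    ext x
    simp [dom]
  -- Projection along a compact factor is closed; on `dom`, these sets are the sublevel sets of the
  -- least parameter.
  have hlow (t : ℝ) : IsClosed {x | ∃ z : cantorSet, (z : ℝ) ≤ t ∧ (x, g z) ∈ R} := by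
    have hle : IsClosed {p : X × cantorSet | (p.2 : ℝ) ≤ t} :=
      isClosed_le (continuous_subtype_val.comp continuous_snd) continuous_const
    convert isClosedMap_fst_of_compactSpace _ (hle.inter hR') using 1
    ext x
    simp
  have hmin (x : X) (hx : x ∈ dom) : ∃ z, (x, g z) ∈ R ∧ ∀ w, (x, g w) ∈ R → (z : ℝ) ≤ w := by
    have hc : IsCompact {z | (x, g z) ∈ R} :=
      (hR'.preimage (Continuous.prodMk_right x)).isCompact
    obtain ⟨z, hz, hzm⟩ := hc.exists_isMinOn hx continuous_subtype_val.continuousOn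
    exact ⟨z, hz, fun w hw => hzm hw⟩
  obtain ⟨z₀⟩ : Nonempty cantorSet := ⟨cantorSetHomeomorphNatToBool.symm fun _ => false⟩
  let F : X → cantorSet := fun x => if hx : x ∈ dom then (hmin x hx).choose else z₀
  have hF (x : X) (hx : x ∈ dom) :
      (x, g (F x)) ∈ R ∧ ∀ w, (x, g w) ∈ R → (F x : ℝ) ≤ w := by
    simp only [F, dif_pos hx]
    exact (hmin x hx).choose_spec
  have hF₀ (x : X) (hx : x ∉ dom) : F x = z₀ := dif_neg hx
  have hFm : Measurable fun x => (F x : ℝ) := by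
    refine measurable_of_Iic fun t => ?_
    have : (fun x => (F x : ℝ)) ⁻¹' Set.Iic t =
        {x | ∃ z : cantorSet, (z : ℝ) ≤ t ∧ (x, g z) ∈ R} ∪ (domᶜ ∩ {_x | (z₀ : ℝ) ≤ t}) := by
      ext x
      by_cases hx : x ∈ dom
      · simp only [Set.mem_preimage, Set.mem_Iic, Set.mem_union, Set.mem_ofPred_eq, Set.mem_inter_iff,
          Set.mem_compl_iff, hx, not_true_eq_false, false_and, or_false]
        exact ⟨fun h => ⟨F x, h, (hF x hx).1⟩, fun ⟨z, hz, hzR⟩ => ((hF x hx).2 z hzR).trans hz⟩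
      · have hne : ¬ ∃ z : cantorSet, (z : ℝ) ≤ t ∧ (x, g z) ∈ R := fun ⟨z, _, hz⟩ => hx ⟨z, hz⟩
        simp only [Set.mem_preimage, Set.mem_Iic, Set.mem_union, Set.mem_ofPred_eq, Set.mem_inter_iff,
          Set.mem_compl_iff, hx, not_false_eq_true, true_and, hne, false_or, hF₀ x hx]
    rw [this]
    exact (hlow t).measurableSet.union (hdom.measurableSet.compl.inter (MeasurableSet.const _))
  refine ⟨fun x => g (F x), hg.measurable.comp (hFm.subtype_mk (h := fun x => (F x).2)), ?_⟩
  rintro x ⟨y, hy⟩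
  obtain ⟨z, rfl⟩ := hgs y
  exact (hF x ⟨z, hy⟩).1

/-! ### Majorization by pairwise transfers -/

/-- If `a` and `c` have the same sum, the partial sums of `a` dominate those of the non-increasing
vector `c`, and a property of vectors passes from any vector to each vector obtained by moving two
entries towards each other, then it passes from `a` to `c`. -/
theorem of_partialSums_le {n : ℕ} {P : (Fin n → ℝ) → Prop}
    (hP : ∀ a : Fin n → ℝ, P a → ∀ i k, i ≠ k → ∀ p q, a k ≤ p → p ≤ a i → p + q = a i + a k →
      P (Function.update (Function.update a i p) k q))
    {c : Fin n → ℝ} (hc : Antitone c) (a : Fin n → ℝ) (ha : P a)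
    (hsum : ∑ i, a i = ∑ i, c i)
    (hle : ∀ r : Fin n, ∑ i with i ≤ r, c i ≤ ∑ i with i ≤ r, a i) : P c := by
  induction hN : (Finset.univ.filter fun i => a i ≠ c i).card using Nat.strong_induction_on
    generalizing a with
  | _ N ih =>
    by_cases hac : a = c
    · exact hac ▸ ha
    have hex : ∃ k, a k < c k := by
      by_contra! h
      refine hac (funext fun i => ?_)
      exact ((Finset.sum_eq_sum_iff_of_le fun i _ => h i).mp hsum.symm i (Finset.mem_univ i)).symm
    -- Take `k` to be the first deficit; the partial sum at `k` then forces a strict surplus at some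
    -- `i < k`.
    obtain ⟨k, hk, hkmin⟩ : ∃ k, a k < c k ∧ ∀ l < k, c l ≤ a l := by
      obtain ⟨k, hk, hmin⟩ := WellFounded.has_min wellFounded_lt {k | a k < c k} hex
      exact ⟨k, hk, fun l hl => not_lt.mp fun h => hmin l h hl⟩
    obtain ⟨i, hik, hi⟩ : ∃ i < k, c i < a i := by
      by_contra! h
      refine (hle k).not_gt (Finset.sum_lt_sum (fun l hl => ?_) ⟨k, by simp, hk⟩)
      rcases (Finset.mem_filter.mp hl).2.lt_or_eq with h' | rfl
      exacts [h l h', hk.le]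
    -- The largest transfer that overshoots neither target: one of the two entries becomes correct,
    -- so the number of disagreements drops.
    set δ := min (a i - c i) (c k - a k) with hδ
    have hδ0 : 0 < δ := lt_min (by linarith) (by linarith)
    have hδ1 : δ ≤ a i - c i := min_le_left _ _
    have hδ2 : δ ≤ c k - a k := min_le_right _ _
    have hcik := hc hik.le
    set a' := Function.update (Function.update a i (a i - δ)) k (a k + δ) with ha'
    have hk' : a' k = a k + δ := by simp [ha']
    have hi' : a' i = a i - δ := by simp [ha', hik.ne]
    have ho' (l) (h1 : l ≠ i) (h2 : l ≠ k) : a' l = a l := by simp [ha', h1, h2]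
    have hs (s : Finset (Fin n)) : ∑ l ∈ s, a' l =
        ∑ l ∈ s, a l - (if i ∈ s then δ else 0) + (if k ∈ s then δ else 0) := by
      have : ∀ l, a' l = a l - (if i = l then δ else 0) + (if k = l then δ else 0) := by
        intro l
        by_cases h1 : l = i
        · subst h1; simp [hi', hik.ne']
        by_cases h2 : l = k
        · subst h2; simp [hk', hik.ne]
        simp [ho' l h1 h2, Ne.symm h1, Ne.symm h2]
      simp [this, Finset.sum_add_distrib, Finset.sum_sub_distrib]
    refine ih _ ?_ a' (hP a ha i k hik.ne _ _ (by linarith) (by linarith) (by ring)) ?_ ?_ rfl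
    · rw [← hN]
      refine Finset.card_lt_card ⟨?_, ?_⟩
      · intro l hl
        simp only [Finset.mem_filter, Finset.mem_univ, true_and] at hl ⊢
        by_cases h1 : l = i
        · subst h1; exact hi.ne'
        by_cases h2 : l = k
        · subst h2; exact hk.ne
        rwa [ho' l h1 h2] at hl
      · intro h
        rcases min_choice (a i - c i) (c k - a k) with h' | h'
        · have := h (Finset.mem_filter.mpr ⟨Finset.mem_univ i, hi.ne'⟩)
          exact (Finset.mem_filter.mp this).2 (by rw [hi']; linarith)
        · have := h (Finset.mem_filter.mpr ⟨Finset.mem_univ k, hk.ne⟩)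
          exact (Finset.mem_filter.mp this).2 (by rw [hk']; linarith)
    · simp [hs, hsum]
    · intro r
      rw [hs]
      have hr := hle r
      by_cases h2 : k ≤ r
      · simpa [h2, hik.le.trans h2] using hr
      by_cases h1 : i ≤ r
      · simp only [Finset.mem_filter, Finset.mem_univ, true_and, h1, h2, if_true, if_false, add_zero]
        -- For `i ≤ r < k` all terms up to `r` are surpluses, so the partial sum can afford to lose
        -- `δ ≤ a i - c i`.
        have : a i - c i ≤ ∑ l with l ≤ r, (a l - c l) :=
          Finset.single_le_sum (f := fun l => a l - c l) (fun l hl => sub_nonneg.mpr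
            (hkmin l ((Finset.mem_filter.mp hl).2.trans_lt (not_le.mp h2)))) (by simp [h1])
        rw [Finset.sum_sub_distrib] at this
        linarith
      · simpa [h1, h2] using hr

/-! ### Rank one matrices and rotations -/

theorem trace_tensor_self {d : ℕ} (x : EuclideanSpace ℂ (Fin d)) :
    (tensor x x).trace = ((‖x‖ ^ 2 : ℝ) : ℂ) := by
  rw [EuclideanSpace.norm_sq_eq, Complex.ofReal_sum]
  refine Finset.sum_congr rfl fun i _ => ?_
  simp only [Matrix.diag_apply, tensor, Matrix.of_apply, Complex.ofReal_pow]
  exact Complex.mul_conj' (x i)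

theorem tensor_ofReal_smul {d : ℕ} (r : ℝ) (x : EuclideanSpace ℂ (Fin d)) :
    tensor ((r : ℂ) • x) ((r : ℂ) • x) = ((r ^ 2 : ℝ) : ℂ) • tensor x x := by
  ext i j
  simp only [tensor, Matrix.of_apply, PiLp.smul_apply, smul_eq_mul, Matrix.smul_apply, star_mul',
    RCLike.star_def, Complex.conj_ofReal, Complex.ofReal_pow]
  ring

theorem tensor_single {d : ℕ} (s : Fin d) (z : ℂ) :
    tensor (EuclideanSpace.single s z) (EuclideanSpace.single s z) =
      Matrix.diagonal (Pi.single s (z * star z)) := by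
  ext i j
  by_cases h : i = j
  · subst h
    by_cases hi : i = s
    · subst hi; simp [tensor]
    · simp [tensor, hi]
  · by_cases hi : i = s
    · subst hi; simp [tensor, h, Ne.symm h]
    · simp [tensor, hi, h]

theorem tensor_rotate {d : ℕ} (x y : EuclideanSpace ℂ (Fin d)) (θ : ℝ) :
    tensor ((Real.cos θ : ℂ) • x + (Real.sin θ : ℂ) • y)
        ((Real.cos θ : ℂ) • x + (Real.sin θ : ℂ) • y) +
      tensor ((-Real.sin θ : ℂ) • x + (Real.cos θ : ℂ) • y)
        ((-Real.sin θ : ℂ) • x + (Real.cos θ : ℂ) • y) = tensor x x + tensor y y := by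
  ext i j
  have h : (Real.cos θ : ℂ) ^ 2 + (Real.sin θ : ℂ) ^ 2 = 1 := by
    exact_mod_cast Real.cos_sq_add_sin_sq θ
  simp only [tensor, Matrix.add_apply, Matrix.of_apply, PiLp.add_apply, PiLp.smul_apply,
    smul_eq_mul, star_add, star_mul', star_neg, RCLike.star_def, Complex.conj_ofReal]
  linear_combination (x i * (starRingEnd ℂ) (x j) + y i * (starRingEnd ℂ) (y j)) * h

/-- A pair of vectors can be rotated so that the squared norms take any prescribed intermediate
values, without changing the sum of the associated rank one matrices. -/
theorem exists_tensor_add_eq_and_norm_sq_eq {d : ℕ} (x y : EuclideanSpace ℂ (Fin d)) {p q : ℝ}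
    (h1 : ‖y‖ ^ 2 ≤ p) (h2 : p ≤ ‖x‖ ^ 2) (hpq : p + q = ‖x‖ ^ 2 + ‖y‖ ^ 2) :
    ∃ x' y' : EuclideanSpace ℂ (Fin d), tensor x' x' + tensor y' y' = tensor x x + tensor y y ∧
      ‖x'‖ ^ 2 = p ∧ ‖y'‖ ^ 2 = q := by
  let f : ℝ → ℝ := fun θ => ‖(Real.cos θ : ℂ) • x + (Real.sin θ : ℂ) • y‖ ^ 2
  have hf : Continuous f := by fun_prop
  obtain ⟨θ, -, hθ⟩ := intermediate_value_Icc' Real.pi_div_two_pos.le hf.continuousOn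
    (show p ∈ Set.Icc (f (Real.pi / 2)) (f 0) by simpa [f] using ⟨h1, h2⟩)
  refine ⟨_, _, tensor_rotate x y θ, hθ, ?_⟩
  -- The trace of the rotation identity fixes the second norm.
  have ht := congrArg Matrix.trace (tensor_rotate x y θ)
  simp only [Matrix.trace_add, trace_tensor_self] at ht
  have hr : f θ + ‖(-Real.sin θ : ℂ) • x + (Real.cos θ : ℂ) • y‖ ^ 2 = ‖x‖ ^ 2 + ‖y‖ ^ 2 := by
    exact_mod_cast ht
  linarith

/-- The vector `a` consists of the squared norms of vectors whose frame matrix is `M`. -/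
def IsFrameNormSq {d n : ℕ} (M : Matrix (Fin d) (Fin d) ℂ) (a : Fin n → ℝ) : Prop :=
  ∃ w : Fin n → EuclideanSpace ℂ (Fin d),
    ∑ j, tensor (w j) (w j) = M ∧ ∀ j, ‖w j‖ ^ 2 = a j

theorem IsFrameNormSq.update {d n : ℕ} {M : Matrix (Fin d) (Fin d) ℂ} (a : Fin n → ℝ)
    (ha : IsFrameNormSq M a) (i k : Fin n) (hik : i ≠ k) (p q : ℝ) (h1 : a k ≤ p) (h2 : p ≤ a i)
    (hpq : p + q = a i + a k) :
    IsFrameNormSq M (Function.update (Function.update a i p) k q) := by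
  obtain ⟨w, hw, hwa⟩ := ha
  rw [← hwa k] at h1 hpq
  rw [← hwa i] at h2 hpq
  obtain ⟨x, y, hxy, hx, hy⟩ := exists_tensor_add_eq_and_norm_sq_eq (w i) (w k) h1 h2 hpq
  refine ⟨Function.update (Function.update w i x) k y, ?_, fun l => ?_⟩
  · have (l : Fin n) : tensor (Function.update (Function.update w i x) k y l)
        (Function.update (Function.update w i x) k y l) = tensor (w l) (w l) +
          ((if i = l then tensor x x - tensor (w i) (w i) else 0) +
            (if k = l then tensor y y - tensor (w k) (w k) else 0)) := by
      by_cases h1 : l = i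
      · subst h1; simp [hik, hik.symm]
      by_cases h2 : l = k
      · subst h2; simp [hik]
      simp [h1, h2, Ne.symm h1, Ne.symm h2]
    simp only [this, Finset.sum_add_distrib, Finset.sum_ite_eq, Finset.mem_univ, if_true, hw]
    rw [add_eq_left, sub_add_sub_comm, hxy, sub_self]
  · by_cases h2 : l = k
    · subst h2; simpa using hy
    by_cases h1 : l = i
    · subst h1; simpa [hik] using hx
    simpa [h1, h2] using hwa l

theorem IsFrameNormSq.comp_perm {d n : ℕ} {M : Matrix (Fin d) (Fin d) ℂ} {a : Fin n → ℝ}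
    (ha : IsFrameNormSq M a) (τ : Equiv.Perm (Fin n)) : IsFrameNormSq M (a ∘ τ) := by
  obtain ⟨w, hw, hwa⟩ := ha
  exact ⟨w ∘ τ, (Equiv.sum_comp τ fun j => tensor (w j) (w j)).trans hw, fun j => hwa (τ j)⟩

/-! ### Rearrangements and partial sums -/

/-- Extension of a finite sequence by zero. -/
def extendZero {M : Type*} [Zero M] {n : ℕ} (f : Fin n → M) (m : ℕ) : M :=
  if h : m < n then f ⟨m, h⟩ else 0

theorem extendZero_val {M : Type*} [Zero M] {n : ℕ} (f : Fin n → M) (i : Fin n) :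
    extendZero f i = f i := by
  simp [extendZero]

theorem sum_filter_val_lt {M : Type*} [AddCommMonoid M] {n : ℕ} (f : Fin n → M) (r : ℕ) :
    ∑ i with i.val < r, f i = ∑ m ∈ Finset.range r, extendZero f m := by
  rw [Finset.sum_filter]
  simp_rw [← extendZero_val f]
  rw [Fin.sum_univ_eq_sum_range (fun m => if m < r then extendZero f m else 0) n,
    ← Finset.sum_filter]
  refine Finset.sum_subset (fun m hm => by simp_all) fun m hm hmn => ?_
  have : ¬ m < n := fun h => hmn (by simp_all)
  simp [extendZero, this]

theorem sum_eq_sum_range {M : Type*} [AddCommMonoid M] {n r : ℕ} (f : Fin n → M)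
    (hf : ∀ m, r ≤ m → extendZero f m = 0) :
    ∑ i, f i = ∑ m ∈ Finset.range r, extendZero f m := by
  rw [← sum_filter_val_lt, Finset.sum_filter_of_ne]
  intro i _ hi
  by_contra! h
  exact hi (by rw [← extendZero_val f, hf _ h])

theorem decRearr_nonneg {n : ℕ} {a : Fin n → ℝ} (ha : ∀ i, 0 ≤ a i) (i : Fin n) :
    0 ≤ decRearr a i := ha _

theorem topSum_eq_sum_range {n : ℕ} (a : Fin n → ℝ) (r : ℕ) :
    topSum a r = ∑ m ∈ Finset.range r, extendZero (decRearr a) m :=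
  sum_filter_val_lt _ _

theorem sum_decRearr {n : ℕ} (a : Fin n → ℝ) : ∑ i, decRearr a i = ∑ i, a i := by
  obtain ⟨σ, hσ⟩ := decRearr_eq_comp_perm a
  rw [hσ]
  exact Equiv.sum_comp σ a

theorem topSum_of_le {n r : ℕ} (a : Fin n → ℝ) (h : n ≤ r) : topSum a r = ∑ i, a i := by
  rw [topSum, Finset.filter_true_of_mem fun i _ => i.2.trans_le h, sum_decRearr]

theorem topSum_mono {n : ℕ} {a : Fin n → ℝ} (ha : ∀ i, 0 ≤ a i) : Monotone (topSum a) :=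
  fun _ _ h => Finset.sum_le_sum_of_subset_of_nonneg
    (fun _ hi => by simp only [Finset.mem_filter] at hi ⊢; exact ⟨hi.1, hi.2.trans_le h⟩)
    fun i _ _ => decRearr_nonneg ha i

theorem topSum_le_sum {n : ℕ} {a : Fin n → ℝ} (ha : ∀ i, 0 ≤ a i) (r : ℕ) :
    topSum a r ≤ ∑ i, a i :=
  (topSum_mono ha (le_max_left r n)).trans_eq (topSum_of_le a (le_max_right r n))

/-- Majorization for nonnegative vectors bounds the partial sums of every length. -/
theorem Majorized.topSum_le {n d : ℕ} {c : Fin n → ℝ} {b : Fin d → ℝ} (h : Majorized c b)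
    (hc : ∀ j, 0 ≤ c j) {r : ℕ} (hr : r ≤ n) : topSum c r ≤ topSum b r := by
  rcases Nat.eq_zero_or_pos r with rfl | hr0
  · simp [topSum]
  rcases le_total r d with hd | hd
  · exact h.1 r hr0 (le_min hr hd)
  · rw [topSum_of_le b hd, ← h.2]
    exact topSum_le_sum hc r

/-- A nonnegative vector majorizing a vector of length `n` has at most `n` nonzero entries. -/
theorem Majorized.extendZero_decRearr_eq_zero {n d : ℕ} {c : Fin n → ℝ} {b : Fin d → ℝ}
    (h : Majorized c b) (hb : ∀ i, 0 ≤ b i) (hc : ∀ j, 0 ≤ c j) (m : ℕ) (hm : n ≤ m) :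
    extendZero (decRearr b) m = 0 := by
  have h1 : ∑ i, b i ≤ topSum b n := by
    rw [← h.2, ← topSum_of_le c le_rfl]
    exact h.topSum_le hc le_rfl
  have h2 := topSum_mono hb hm
  have h3 := topSum_le_sum hb (m + 1)
  rw [topSum_eq_sum_range, Finset.sum_range_succ, ← topSum_eq_sum_range] at h3
  refine le_antisymm (by linarith) ?_
  unfold extendZero
  split_ifs with hmd
  exacts [decRearr_nonneg hb _, le_rfl]

/-! ### Existence of frames -/

/-- The scaled basis vectors realize the rearranged eigenvalues as squared norms. -/
theorem Majorized.isFrameNormSq_extendZero {n d : ℕ} {c : Fin n → ℝ} {b : Fin d → ℝ}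
    (h : Majorized c b) (hb : ∀ i, 0 ≤ b i) (hc : ∀ j, 0 ≤ c j) :
    IsFrameNormSq (Matrix.diagonal fun i => (b i : ℂ))
      fun j : Fin n => extendZero (decRearr b) j := by
  obtain ⟨σ, hσ⟩ := decRearr_eq_comp_perm b
  let w : Fin d → EuclideanSpace ℂ (Fin d) := fun i =>
    EuclideanSpace.single (σ i) ((√(b (σ i)) : ℝ) : ℂ)
  have hw (i : Fin d) : tensor (w i) (w i) =
      Matrix.diagonal (Pi.single (σ i) (b (σ i) : ℂ)) := by
    rw [tensor_single]
    congr 2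
    rw [RCLike.star_def, Complex.conj_ofReal, ← Complex.ofReal_mul, Real.mul_self_sqrt (hb _)]
  have hsum : ∑ i, tensor (w i) (w i) = Matrix.diagonal fun i => (b i : ℂ) := by
    simp_rw [hw]
    rw [Equiv.sum_comp σ fun i => Matrix.diagonal (Pi.single i (b i : ℂ))]
    ext i j
    rw [Matrix.sum_apply]
    by_cases hij : i = j
    · subst hij; simp [Pi.single_apply]
    · simp [hij]
  have hnorm (i : Fin d) : ‖w i‖ ^ 2 = decRearr b i := by
    simp [w, hσ, Real.sq_sqrt (hb _)]
  have hval (m : ℕ) : extendZero (fun i => tensor (w i) (w i)) m =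
      tensor (extendZero w m) (extendZero w m) := by
    unfold extendZero
    split_ifs
    · rfl
    · ext; simp [tensor]
  -- Passing from length `d` to `n` pads with zeros or drops vectors that vanish by majorization.
  refine ⟨fun j => extendZero w j, ?_, fun j => ?_⟩
  · rw [← hsum, sum_eq_sum_range (r := n) fun i => tensor (w i) (w i)]
    · simp_rw [hval]
      exact Fin.sum_univ_eq_sum_range (fun m => tensor (extendZero w m) (extendZero w m)) n
    · intro m hm
      have := h.extendZero_decRearr_eq_zero hb hc m hm
      unfold extendZero at this ⊢
      split_ifs with hmd
      · rw [dif_pos hmd, hσ, Function.comp_apply] at this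
        simp only [hw, this, Complex.ofReal_zero, Pi.single_zero]
        exact Matrix.diagonal_zero
      · rfl
  · simp only [extendZero]
    split_ifs
    exacts [hnorm _, by simp]

theorem Majorized.isFrameNormSq {n d : ℕ} {c : Fin n → ℝ} {b : Fin d → ℝ}
    (h : Majorized c b) (hb : ∀ i, 0 ≤ b i) (hc : ∀ j, 0 ≤ c j) :
    IsFrameNormSq (Matrix.diagonal fun i => (b i : ℂ)) c := by
  obtain ⟨τ, hτ⟩ := decRearr_eq_comp_perm c
  have key : IsFrameNormSq (Matrix.diagonal fun i => (b i : ℂ)) (decRearr c) := by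
    refine of_partialSums_le IsFrameNormSq.update (decRearr_antitone c) _
      (h.isFrameNormSq_extendZero hb hc) ?_ fun r => ?_
    · rw [Fin.sum_univ_eq_sum_range, sum_decRearr, h.2, ← sum_decRearr b]
      exact (sum_eq_sum_range _ (h.extendZero_decRearr_eq_zero hb hc)).symm
    · simp_rw [Fin.le_def, ← Nat.lt_succ_iff]
      refine (h.topSum_le hc (Nat.succ_le_of_lt r.2)).trans_eq ?_
      rw [topSum_eq_sum_range, sum_filter_val_lt]
      refine Finset.sum_congr rfl fun m hm => ?_
      have hmn : m < n := (Finset.mem_range.mp hm).trans_le (Nat.succ_le_of_lt r.2)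
      simp [extendZero, hmn]
  have := key.comp_perm τ.symm
  rwa [hτ, Function.comp_assoc, Equiv.self_comp_symm, Function.comp_id] at this

/-- Schur–Horn theorem for frames, existence part: vectors of prescribed norms with a prescribed
diagonal frame matrix. -/
theorem Majorized.exists_unit_vectors {n d : ℕ} (hd : 1 ≤ d) {c : Fin n → ℝ} {b : Fin d → ℝ}
    (h : Majorized c b) (hb : ∀ i, 0 ≤ b i) (hc : ∀ j, 0 ≤ c j) :
    ∃ u : Fin n → EuclideanSpace ℂ (Fin d), (∀ j, ‖u j‖ = 1) ∧
      Matrix.diagonal (fun i => (b i : ℂ)) = ∑ j, (c j : ℂ) • tensor (u j) (u j) := by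
  obtain ⟨w, hw, hwc⟩ := h.isFrameNormSq hb hc
  -- If `w j = 0` then `c j = 0`, so any unit vector serves; one exists because `1 ≤ d`.
  refine ⟨fun j => if w j = 0 then EuclideanSpace.single ⟨0, hd⟩ 1 else
    ((‖w j‖⁻¹ : ℝ) : ℂ) • w j, fun j => ?_, ?_⟩
  · dsimp only
    split_ifs with hj
    · simp
    · rw [norm_smul, Complex.norm_real, norm_inv, norm_norm,
        inv_mul_cancel₀ (norm_ne_zero_iff.mpr hj)]
  · rw [← hw]
    refine Finset.sum_congr rfl fun j _ => ?_
    dsimp only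
    split_ifs with hj
    · rw [← hwc j, hj]
      ext
      simp [tensor]
    · rw [tensor_ofReal_smul, smul_smul, ← Complex.ofReal_mul, ← hwc j, inv_pow,
        mul_inv_cancel₀ (pow_ne_zero 2 (norm_ne_zero_iff.mpr hj)), Complex.ofReal_one, one_smul]

/-! ### Necessity of majorization -/

/-- A weighted sum with weights in `[0, 1]` of total mass at most `r` is at most the sum of the `r`
largest entries. -/
theorem sum_mul_le_topSum {d r : ℕ} {b t : Fin d → ℝ} (hb : ∀ i, 0 ≤ b i) (hr : 1 ≤ r)
    (hrd : r ≤ d) (ht0 : ∀ i, 0 ≤ t i) (ht1 : ∀ i, t i ≤ 1) (hts : ∑ i, t i ≤ r) :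
    ∑ i, b i * t i ≤ topSum b r := by
  obtain ⟨σ, hσ⟩ := decRearr_eq_comp_perm b
  -- Position of the `r`-th largest entry. After subtracting this threshold, full weight on the
  -- first `r` entries and none on the rest is optimal.
  let s : Fin d := ⟨r - 1, by omega⟩
  have hcard : ∑ i : Fin d with i.val < r, (1 : ℝ) = r := by
    rw [sum_filter_val_lt, Finset.sum_congr rfl (g := fun _ => (1 : ℝ))]
    · simp
    · intro m hm
      have : m < d := (Finset.mem_range.mp hm).trans_le hrd
      simp [extendZero, this]
  have hle : ∑ i, (decRearr b i - decRearr b s) * t (σ i) ≤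
      ∑ i : Fin d with i.val < r, (decRearr b i - decRearr b s) := by
    rw [Finset.sum_filter]
    refine Finset.sum_le_sum fun i _ => ?_
    split_ifs with hi
    · have := decRearr_antitone b (show i ≤ s from Fin.le_def.mpr (by simp only [s]; omega))
      exact mul_le_of_le_one_right (sub_nonneg.mpr this) (ht1 _)
    · have := decRearr_antitone b (show s ≤ i from Fin.le_def.mpr (by simp only [s]; omega))
      exact mul_nonpos_of_nonpos_of_nonneg (sub_nonpos.mpr this) (ht0 _)
  have hs : decRearr b s * ∑ i, t (σ i) ≤ decRearr b s * r := by
    rw [Equiv.sum_comp σ t]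
    exact mul_le_mul_of_nonneg_left hts (decRearr_nonneg hb s)
  have hbt : ∑ i, b i * t i = ∑ i, decRearr b i * t (σ i) := by
    rw [hσ, ← Equiv.sum_comp σ]
    rfl
  have hconst : ∑ i : Fin d with i.val < r, decRearr b s = decRearr b s * r := by
    rw [← hcard, Finset.mul_sum]
    simp
  simp only [sub_mul, Finset.sum_sub_distrib, ← Finset.mul_sum] at hle
  rw [hbt, topSum]
  linarith

variable {d n : ℕ} {b : Fin d → ℝ} {c : Fin n → ℝ} {u : Fin n → EuclideanSpace ℂ (Fin d)}

theorem sum_eq_sum_of_frame (hu : ∀ j, ‖u j‖ = 1)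
    (h : Matrix.diagonal (fun i => (b i : ℂ)) = ∑ j, (c j : ℂ) • tensor (u j) (u j)) :
    ∑ j, c j = ∑ i, b i := by
  have ht := congrArg Matrix.trace h
  simp only [Matrix.trace_sum, Matrix.trace_smul, trace_tensor_self, hu, Matrix.trace_diagonal,
    one_pow, Complex.ofReal_one, smul_eq_mul, mul_one] at ht
  exact_mod_cast ht.symm

theorem diagonal_entry_of_frame
    (h : Matrix.diagonal (fun i => (b i : ℂ)) = ∑ j, (c j : ℂ) • tensor (u j) (u j)) (i : Fin d) :
    b i = ∑ j, c j * ‖u j i‖ ^ 2 := by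
  have ht := congrFun (congrFun h i) i
  simp only [Matrix.diagonal_apply_eq, Matrix.sum_apply, Matrix.smul_apply, tensor,
    Matrix.of_apply, smul_eq_mul, RCLike.star_def, Complex.mul_conj'] at ht
  exact_mod_cast ht

/-- The quadratic form of the frame matrix. -/
theorem quadraticForm_of_frame
    (h : Matrix.diagonal (fun i => (b i : ℂ)) = ∑ j, (c j : ℂ) • tensor (u j) (u j))
    (y : Fin d → ℂ) :
    ∑ i, b i * ‖y i‖ ^ 2 = ∑ j, c j * ‖∑ i, star (y i) * u j i‖ ^ 2 := by
  have ht := congrArg (fun M : Matrix (Fin d) (Fin d) ℂ => ∑ i, ∑ l, star (y i) * M i l * y l) h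
  have hl : ∑ i, ∑ l, star (y i) * Matrix.diagonal (fun i => (b i : ℂ)) i l * y l =
      ((∑ i, b i * ‖y i‖ ^ 2 : ℝ) : ℂ) := by
    push_cast
    refine Finset.sum_congr rfl fun i _ => ?_
    rw [Finset.sum_eq_single i (fun l _ hl => by simp [hl.symm]) (by simp),
      Matrix.diagonal_apply_eq, ← Complex.mul_conj', RCLike.star_def]
    ring
  have hr : ∑ i, ∑ l, star (y i) * (∑ j, (c j : ℂ) • tensor (u j) (u j)) i l * y l =
      ((∑ j, c j * ‖∑ i, star (y i) * u j i‖ ^ 2 : ℝ) : ℂ) := by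
    push_cast
    simp only [← Complex.mul_conj', map_sum, map_mul, RCLike.star_def, Complex.conj_conj,
      Matrix.sum_apply, Matrix.smul_apply, tensor, Matrix.of_apply, smul_eq_mul, Finset.mul_sum,
      Finset.sum_mul]
    rw [Finset.sum_comm' (t' := Finset.univ) (s' := fun _ => Finset.univ) (by simp)]
    conv_lhs => enter [2, l]; rw [Finset.sum_comm]
    rw [Finset.sum_comm]
    refine Finset.sum_congr rfl fun j _ => Finset.sum_congr rfl fun l _ =>
      Finset.sum_congr rfl fun i _ => ?_
    ring
  exact_mod_cast hl.symm.trans (ht.trans hr)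

/-- Since `D_b` dominates `c j • tensor (u j) (u j)`, testing both quadratic forms on `D_b⁻¹ u j`
gives `c j * Q ^ 2 ≤ Q`. Division by zero drops the coordinates with `b i = 0`. -/
theorem sum_div_le_one_of_frame (hb : ∀ i, 0 ≤ b i) (hc : ∀ j, 0 ≤ c j)
    (h : Matrix.diagonal (fun i => (b i : ℂ)) = ∑ j, (c j : ℂ) • tensor (u j) (u j)) (j : Fin n) :
    ∑ i, c j * ‖u j i‖ ^ 2 / b i ≤ 1 := by
  set Q := ∑ i, ‖u j i‖ ^ 2 / b i with hQ
  have hQ0 : 0 ≤ Q := Finset.sum_nonneg fun i _ => div_nonneg (sq_nonneg _) (hb i)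
  have hq := quadraticForm_of_frame h fun i => u j i / b i
  have hl : ∑ i, b i * ‖u j i / (b i : ℂ)‖ ^ 2 = Q := by
    refine Finset.sum_congr rfl fun i _ => ?_
    rw [norm_div, Complex.norm_real, Real.norm_of_nonneg (hb i)]
    rcases (hb i).eq_or_lt with h0 | h0
    · simp [← h0]
    · field_simp
  have hj : ∑ i, star (u j i / (b i : ℂ)) * u j i = (Q : ℂ) := by
    rw [hQ]
    push_cast
    refine Finset.sum_congr rfl fun i _ => ?_
    rw [← Complex.mul_conj', RCLike.star_def, map_div₀, Complex.conj_ofReal]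
    ring
  have hle : c j * Q ^ 2 ≤ Q := by
    rw [hl] at hq
    rw [hq]
    have := Finset.single_le_sum (f := fun l => c l * ‖∑ i, star (u j i / (b i : ℂ)) * u l i‖ ^ 2)
      (fun l _ => mul_nonneg (hc l) (sq_nonneg _)) (Finset.mem_univ j)
    simp only [hj, Complex.norm_real, Real.norm_of_nonneg hQ0] at this
    rwa [← hq] at this ⊢
  have heq : ∑ i, c j * ‖u j i‖ ^ 2 / b i = c j * Q := by
    rw [hQ, Finset.mul_sum]
    exact Finset.sum_congr rfl fun i _ => mul_div_assoc _ _ _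
  rw [heq]
  rcases hQ0.eq_or_lt with h0 | h0
  · simp [← h0]
  · nlinarith

/-- Schur–Horn theorem for frames, necessity part. -/
theorem majorized_of_frame (hb : ∀ i, 0 ≤ b i) (hc : ∀ j, 0 ≤ c j) (hu : ∀ j, ‖u j‖ = 1)
    (h : Matrix.diagonal (fun i => (b i : ℂ)) = ∑ j, (c j : ℂ) • tensor (u j) (u j)) :
    Majorized c b := by
  refine ⟨fun r hr1 hr => ?_, sum_eq_sum_of_frame hu h⟩
  obtain ⟨τ, hτ⟩ := decRearr_eq_comp_perm c
  -- Where `b i = 0`, the diagonal entry forces every `c j * ‖u j i‖ ^ 2` to vanish, so dividing by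
  -- `b i` loses nothing.
  have hmul (i : Fin d) (j : Fin n) : b i * (c j * ‖u j i‖ ^ 2 / b i) = c j * ‖u j i‖ ^ 2 := by
    rcases eq_or_ne (b i) 0 with h0 | h0
    · have := diagonal_entry_of_frame h i
      rw [h0, eq_comm, Finset.sum_eq_zero_iff_of_nonneg
        fun j _ => mul_nonneg (hc j) (sq_nonneg _)] at this
      rw [h0, zero_mul, this j (Finset.mem_univ j)]
    · exact mul_div_cancel₀ _ h0
  have h0 (i : Fin d) (j : Fin n) : 0 ≤ c j * ‖u j i‖ ^ 2 / b i :=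
    div_nonneg (mul_nonneg (hc j) (sq_nonneg _)) (hb i)
  let t : Fin d → ℝ := fun i => ∑ l : Fin n with l.val < r, c (τ l) * ‖u (τ l) i‖ ^ 2 / b i
  have hsum : topSum c r = ∑ i, b i * t i := by
    simp only [t, Finset.mul_sum, hmul]
    rw [Finset.sum_comm, topSum, hτ]
    refine Finset.sum_congr rfl fun l _ => ?_
    rw [← Finset.mul_sum, ← EuclideanSpace.norm_sq_eq, hu, one_pow, mul_one, Function.comp_apply]
  rw [hsum]
  refine sum_mul_le_topSum hb hr1 (hr.trans (min_le_right _ _))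
    (fun i => Finset.sum_nonneg fun l _ => h0 i _) (fun i => ?_) ?_
  · calc t i ≤ ∑ l, c (τ l) * ‖u (τ l) i‖ ^ 2 / b i :=
        Finset.sum_le_sum_of_subset_of_nonneg (Finset.filter_subset _ _) fun l _ _ => h0 i _
      _ = (∑ j, c j * ‖u j i‖ ^ 2) / b i := by
        rw [Equiv.sum_comp τ fun j => c j * ‖u j i‖ ^ 2 / b i, Finset.sum_div]
      _ ≤ 1 := by
        rw [← diagonal_entry_of_frame h i]
        exact div_self_le_one _
  · calc ∑ i, t i = ∑ l : Fin n with l.val < r, ∑ i, c (τ l) * ‖u (τ l) i‖ ^ 2 / b i :=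
        Finset.sum_comm
      _ ≤ ∑ l : Fin n with l.val < r, (1 : ℝ) :=
        Finset.sum_le_sum fun l _ => sum_div_le_one_of_frame hb hc h _
      _ ≤ r := by
        rw [sum_filter_val_lt]
        refine (Finset.sum_le_sum (g := fun _ => (1 : ℝ)) fun m _ => ?_).trans_eq (by simp)
        unfold extendZero
        split_ifs <;> simp

/-! ### Borel choice of the frame -/

/-- The unit vectors realizing a majorization can be chosen as Borel functions of the data. -/
theorem exists_measurable_unit_vectors (d n : ℕ) (hd : 1 ≤ d) :
    ∃ f : (Fin d → ℝ) × (Fin n → ℝ) → Fin n → EuclideanSpace ℂ (Fin d), Measurable f ∧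
      (∀ p j, ‖f p j‖ = 1) ∧
      ∀ p, (∀ i, 0 ≤ p.1 i) → (∀ j, 0 ≤ p.2 j) → Majorized p.2 p.1 →
        Matrix.diagonal (fun i => (p.1 i : ℂ)) =
          ∑ j, (p.2 j : ℂ) • tensor (f p j) (f p j) := by
  let S := Metric.sphere (0 : EuclideanSpace ℂ (Fin d)) 1
  have : Nonempty S := ⟨EuclideanSpace.single ⟨0, hd⟩ 1, by simp [S]⟩
  -- The relation omits majorization, which need not be closed here: it only serves to make the
  -- fibre nonempty.
  have hR : IsClosed {q : ((Fin d → ℝ) × (Fin n → ℝ)) × (Fin n → S) |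
      Matrix.diagonal (fun i => (q.1.1 i : ℂ)) =
        ∑ j, (q.1.2 j : ℂ) • tensor (q.2 j : EuclideanSpace ℂ (Fin d)) (q.2 j)} := by
    refine isClosed_eq ?_ ?_
    · fun_prop
    · refine continuous_matrix fun i l => ?_
      simp only [Matrix.sum_apply, Matrix.smul_apply, tensor, Matrix.of_apply]
      fun_prop
  obtain ⟨f, hf, hfR⟩ := exists_measurable_selector_of_isClosed hR
  refine ⟨fun p j => f p j, measurable_pi_lambda _ fun j =>
    measurable_subtype_coe.comp ((measurable_pi_apply j).comp hf), fun p j => ?_, ?_⟩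
  · simp [S]
  · intro p hb hc h
    obtain ⟨u, hu, hu'⟩ := h.exists_unit_vectors hd hb hc
    exact hfR p ⟨fun j => ⟨u j, by simp [S, hu j]⟩, hu'⟩

end FrameSchurHorn

theorem theorem3p4 (k d n : ℕ) (hd : 1 ≤ d)
    (b : FrameSchurHorn.Torus k → Fin d → ℝ) (c : FrameSchurHorn.Torus k → Fin n → ℝ)
    (hb : Measurable b) (hc : Measurable c)
    (hb0 : ∀ x i, 0 ≤ b x i) (hc0 : ∀ x j, 0 ≤ c x j) :
    (∀ᵐ x : FrameSchurHorn.Torus k, FrameSchurHorn.Majorized (c x) (b x)) ↔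
      ∃ u : Fin n → FrameSchurHorn.Torus k → EuclideanSpace ℂ (Fin d),
        (∀ j, Measurable (u j)) ∧
        (∀ j, ∀ᵐ x : FrameSchurHorn.Torus k, ‖u j x‖ = 1) ∧
        (∀ᵐ x : FrameSchurHorn.Torus k,
          Matrix.diagonal (fun i => (b x i : ℂ)) =
            ∑ j, (c x j : ℂ) • FrameSchurHorn.tensor (u j x) (u j x)) := by
  constructor
  · intro h
    obtain ⟨f, hf, hf1, hfM⟩ := FrameSchurHorn.exists_measurable_unit_vectors d n hd
    refine ⟨fun j x => f (b x, c x) j,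
      fun j => (measurable_pi_apply j).comp (hf.comp (hb.prodMk hc)),
      fun j => Filter.Eventually.of_forall fun x => hf1 _ j, ?_⟩
    filter_upwards [h] with x hx
    exact hfM (b x, c x) (hb0 x) (hc0 x) hx
  · rintro ⟨u, -, hu, h⟩
    filter_upwards [ae_all_iff.mpr hu, h] with x hux hx
    exact FrameSchurHorn.majorized_of_frame (hb0 x) (hc0 x) hux hx
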